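/- Let $k$ be an infinite field, let $n\ge 1$, and let $S=k[x_1,\dots,x_n]$ be the standard graded polynomial ring, with the graded reverse lexicographic order with $x_1>x_2>\dots>x_n$. For an ideal $I\subseteq S$, let $\mathrm{in}(I)$ be the ideal generated by the largest monomials of the nonzero elements of $I$. Each $\alpha\in GL_n(k)$ acts on $S$ by the induced linear change of coordinates. The generic initial ideal $\mathrm{gin}(I)$ is the ideal $J$ such that $\mathrm{in}(\alpha(I))=J$ for all $\alpha$ in some nonempty Zariski open subset of $GL_n(k)$. Let $P\subset S$ be a homogeneous prime ideal and let $J=\mathrm{gin}(P)$. If $\mathrm{ht}(J)=1$, then $J=(x_1^e)$ for some integer $e>0$. -/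

import Mathlib

open MvPolynomial

-- the standard grading of the polynomial ring
attribute [local instance] MvPolynomial.gradedAlgebra

/-- Type synonym for exponent vectors of monomials in `x₁, …, xₙ` (indexed by `0, …, n - 1`),
carrying the graded reverse lexicographic order. -/
def DegRevLex (n : ℕ) : Type := Fin n →₀ ℕ

namespace DegRevLex

variable {n : ℕ}

noncomputable instance : AddCommMonoid (DegRevLex n) :=
  inferInstanceAs (AddCommMonoid (Fin n →₀ ℕ))

/-- The identity map, as an additive equivalence. -/
noncomputable def equiv (n : ℕ) : (Fin n →₀ ℕ) ≃+ DegRevLex n := AddEquiv.refl _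

/-- The comparison key: first the total degree, then the exponents read from the last variable
to the first one, compared lexicographically in the reversed sense. -/
noncomputable def key (a : DegRevLex n) : ℕ ×ₗ (Lex (Fin n → ℕ))ᵒᵈ :=
  toLex (((equiv n).symm a).degree,
    OrderDual.toDual (toLex (fun i => (equiv n).symm a i.rev)))

theorem key_injective : Function.Injective (key (n := n)) := by
  intro a b h
  have h2 := congrArg (fun z => ofLex (OrderDual.ofDual (ofLex z).2)) h
  apply (equiv n).symm.injective
  ext i
  have := congrFun h2 i.rev
  simpa [key] using this

noncomputable instance : LinearOrder (DegRevLex n) := LinearOrder.lift' key key_injective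

theorem lt_iff_key {a b : DegRevLex n} : a < b ↔ key a < key b := Iff.rfl

/-- `u < v` in the graded reverse lexicographic order iff `deg u < deg v`, or `deg u = deg v` and,
at the last variable where the exponents differ, the exponent of `u` is the larger one. -/
theorem lt_iff {a b : Fin n →₀ ℕ} : equiv n a < equiv n b ↔
    a.degree < b.degree ∨
      (a.degree = b.degree ∧ ∃ i, (∀ j, i < j → a j = b j) ∧ b i < a i) := by
  rw [lt_iff_key, key, key, Prod.Lex.toLex_lt_toLex]
  simp only [AddEquiv.symm_apply_apply, OrderDual.toDual_lt_toDual]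
  refine or_congr Iff.rfl (and_congr Iff.rfl ?_)
  constructor
  · rintro ⟨i, h1, h2⟩
    refine ⟨i.rev, fun j hj => ?_, by simpa using h2⟩
    have := h1 j.rev (by rwa [Fin.rev_lt_iff] at hj)
    simpa using this.symm
  · rintro ⟨i, h1, h2⟩
    refine ⟨i.rev, fun j hj => ?_, by simpa using h2⟩
    have := h1 j.rev (Fin.lt_rev_iff.mp hj)
    simpa using this.symm

instance : IsOrderedAddMonoid (DegRevLex n) where
  add_le_add_left a b hab c := by
    rcases hab.eq_or_lt with rfl | h
    · exact le_rfl
    · apply le_of_lt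
      obtain ⟨a, rfl⟩ := (equiv n).surjective a
      obtain ⟨b, rfl⟩ := (equiv n).surjective b
      obtain ⟨c, rfl⟩ := (equiv n).surjective c
      rw [← map_add, ← map_add, lt_iff]
      rw [lt_iff] at h
      simpa using h

theorem equiv_monotone : Monotone (equiv n) := by
  intro a b hab
  obtain ⟨c, rfl⟩ := le_iff_exists_add.mp hab
  rw [map_add]
  suffices h : equiv n 0 ≤ equiv n c by simpa using add_le_add_right h (equiv n a)
  by_cases hc : c = 0
  · rw [hc]
  · refine (lt_iff.mpr (Or.inl ?_)).le
    rw [map_zero]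
    exact Nat.pos_of_ne_zero (by rwa [Ne, Finsupp.degree_eq_zero_iff])

instance : WellFoundedLT (DegRevLex n) := by
  have : WellQuasiOrderedLE (DegRevLex n) := ⟨fun f => by
    obtain ⟨i, j, hij, h⟩ := wellQuasiOrdered_le (fun m => (equiv n).symm (f m))
    exact ⟨i, j, hij, by simpa using equiv_monotone h⟩⟩
  infer_instance

end DegRevLex

/-- The graded reverse lexicographic order with `x₁ > x₂ > ⋯ > xₙ`. -/
noncomputable def degRevLex (n : ℕ) : MonomialOrder (Fin n) where
  syn := DegRevLex n
  toSyn := DegRevLex.equiv n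
  toSyn_monotone := DegRevLex.equiv_monotone

/-- The initial ideal: generated by the largest monomials of the nonzero elements of `I`. -/
noncomputable def initialIdeal {n : ℕ} {k : Type*} [Field k] (m : MonomialOrder (Fin n))
    (I : Ideal (MvPolynomial (Fin n) k)) : Ideal (MvPolynomial (Fin n) k) :=
  Ideal.span {u | ∃ f ∈ I, f ≠ 0 ∧ u = monomial (m.degree f) 1}

/-- The linear change of coordinates of `k[x₁, …, xₙ]` induced by a matrix `α ∈ GLₙ(k)`:
`x_j ↦ ∑ i, α i j * x_i`. -/
noncomputable def linearChange {n : ℕ} {k : Type*} [Field k] (α : GL (Fin n) k) :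
    MvPolynomial (Fin n) k →ₐ[k] MvPolynomial (Fin n) k :=
  aeval (fun j => ∑ i, C (α i j) * X i)

/-- `U ⊆ GLₙ(k)` is Zariski open: it is the complement of the common zero locus of a set of
polynomials in the matrix entries. -/
def IsZariskiOpen {n : ℕ} {k : Type*} [Field k] (U : Set (GL (Fin n) k)) : Prop :=
  ∃ T : Set (MvPolynomial (Fin n × Fin n) k),
    U = {α | ∃ p ∈ T, eval (fun ij => α ij.1 ij.2) p ≠ 0}

/-- `J = gin(I)`: the generic initial ideal with respect to the graded reverse lexicographic order,
that is, `J` is the initial ideal of `α(I)` for all `α` in some nonempty Zariski open subset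
of `GLₙ(k)`. -/
def IsGin {n : ℕ} {k : Type*} [Field k] (J I : Ideal (MvPolynomial (Fin n) k)) : Prop :=
  ∃ U : Set (GL (Fin n) k), IsZariskiOpen U ∧ U.Nonempty ∧
    ∀ α ∈ U, initialIdeal (degRevLex n) (I.map (linearChange α)) = J

/-! A height one initial ideal of a transform `Q = α(P)` lies in some `(x_i)`. So every nonzero
element of `Q` has leading monomial divisible by `x_i`, hence involves `x_i`, and `Q` meets the
polynomial ring in the other variables only in zero. Gauss's lemma then makes `Q`, and so `P`,
principal (`isPrincipal_of_height_initialIdeal_eq_one`). For `P = (f)` with top form `F` of degree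
`d`, the coefficient of `x_1^d` in `α(f)` is the value of `F` at the first row of `α`. It is nonzero
for some `α` in the given open set, as `k` is infinite, and then `x_1^d` is the leading monomial
(`degree_linearChange_degRevLex`). -/

/-- A nonzero prime of `R[X]`, `R` a unique factorization domain, that meets `R` only in zero
is principal. -/
theorem Polynomial.isPrincipal_of_isPrime_of_comap_C_eq_bot {R : Type*} [CommRing R] [IsDomain R]
    [UniqueFactorizationMonoid R] {Q : Ideal (Polynomial R)} [Q.IsPrime] (hQ0 : Q ≠ ⊥)
    (hQ : ∀ r : R, Polynomial.C r ∈ Q → r = 0) : ∃ f, Q = Ideal.span {f} := by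
  classical
  obtain ⟨f, hfQ, hf⟩ := Ideal.IsPrime.exists_mem_prime_of_ne_bot ‹Q.IsPrime› hQ0
  refine ⟨f, le_antisymm (fun g hg => ?_) ((Ideal.span_singleton_le_iff_mem _).mpr hfQ)⟩
  rw [Ideal.mem_span_singleton]
  let K := FractionRing R
  let _ : StrongNormalizationMonoid R := UniqueFactorizationMonoid.strongNormalizationMonoid
  let _ : NormalizedGCDMonoid R := UniqueFactorizationMonoid.toNormalizedGCDMonoid R
  have hdeg : f.natDegree ≠ 0 := by
    intro h
    rw [Polynomial.eq_C_of_natDegree_eq_zero h] at hfQ hf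
    exact hf.ne_zero (by rw [hQ _ hfQ, map_zero])
  have hprim : f.IsPrimitive := hf.irreducible.isPrimitive hdeg
  rw [hprim.dvd_iff_fraction_map_dvd_fraction_map (K := K)]
  -- If `f` did not divide `g` over the fraction field, a Bézout identity there, cleared of
  -- denominators, would put a nonzero constant of `R` into `Q`.
  by_contra hdvd
  have hirr := (hprim.irreducible_iff_irreducible_map_fraction_map (K := K)).mp hf.irreducible
  obtain ⟨a, b, hab⟩ := (hirr.coprime_iff_not_dvd).mpr hdvd
  obtain ⟨s, hs, hsa⟩ := IsLocalization.integerNormalization_spec (nonZeroDivisors R) a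
  obtain ⟨t, ht, htb⟩ := IsLocalization.integerNormalization_spec (nonZeroDivisors R) b
  set a' := IsLocalization.integerNormalization (nonZeroDivisors R) a
  set b' := IsLocalization.integerNormalization (nonZeroDivisors R) b
  have hst : Polynomial.C (s * t) = Polynomial.C t * a' * f + Polynomial.C s * b' * g := by
    apply Polynomial.map_injective (algebraMap R K) (IsFractionRing.injective R K)
    simp only [Polynomial.map_add, Polynomial.map_mul, hsa, htb, Polynomial.map_C,
      Algebra.smul_def, Polynomial.algebraMap_apply, map_mul]
    linear_combination (-Polynomial.C (algebraMap R K s) * Polynomial.C (algebraMap R K t)) * hab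
  refine mul_ne_zero (nonZeroDivisors.ne_zero hs) (nonZeroDivisors.ne_zero ht) (hQ _ ?_)
  rw [hst]
  exact Q.add_mem (Q.mul_mem_left _ hfQ) (Q.mul_mem_left _ hg)

/-- A nonzero prime of a polynomial ring over a field containing no nonzero polynomial free of
the variable `i` is principal. -/
theorem MvPolynomial.isPrincipal_of_isPrime_of_notMem_vars {σ k : Type*} [Field k] (i : σ)
    {Q : Ideal (MvPolynomial σ k)} [Q.IsPrime] (hQ0 : Q ≠ ⊥)
    (hQ : ∀ g ∈ Q, i ∉ g.vars → g = 0) : ∃ f, Q = Ideal.span {f} := by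
  classical
  let e : MvPolynomial σ k ≃ₐ[k] Polynomial (MvPolynomial {j // j ≠ i} k) :=
    (renameEquiv k (Equiv.optionSubtypeNe i).symm).trans (optionEquivLeft k _)
  have heC : ∀ r, e (rename Subtype.val r) = Polynomial.C r := by
    intro r
    have : (e.toAlgHom.comp (rename Subtype.val)) = 
        IsScalarTower.toAlgHom k (MvPolynomial {j // j ≠ i} k) _ := by
      ext j : 1
      simp [e, Equiv.optionSubtypeNe_symm_of_ne j.2]
    exact DFunLike.congr_fun this r
  have hmem : ∀ x, x ∈ Q.comap e.symm ↔ e.symm x ∈ Q := fun x => Iff.rfl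
  obtain ⟨f, hf⟩ := Polynomial.isPrincipal_of_isPrime_of_comap_C_eq_bot
    (Q := Q.comap e.symm) (by
      intro h
      apply hQ0
      rw [eq_bot_iff] at h ⊢
      intro x hx
      have := h (show e x ∈ _ by rw [hmem]; simpa using hx)
      simpa using this) (by
      intro r hr
      rw [hmem, ← heC, AlgEquiv.symm_apply_apply] at hr
      have := hQ _ hr (by
        intro hi
        obtain ⟨j, -, hj⟩ := mem_vars_rename _ _ hi
        exact j.2 hj)
      exact (map_eq_zero_iff _ (rename_injective _ Subtype.val_injective)).mp this)
  refine ⟨e.symm f, ?_⟩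
  ext x
  have h1 : x ∈ Q ↔ e x ∈ Q.comap e.symm := by rw [hmem]; simp
  rw [h1, hf, Ideal.mem_span_singleton, Ideal.mem_span_singleton, ← map_dvd_iff e.symm]
  simp

/-! ### Linear changes of coordinates -/

section LinearChange

variable {n : ℕ} {k : Type*} [Field k]

theorem linearChange_X (α : GL (Fin n) k) (j : Fin n) :
    linearChange α (X j) = ∑ i, C (α i j) * X i := by
  simp [linearChange]

theorem linearChange_comp (α β : GL (Fin n) k) :
    (linearChange α).comp (linearChange β) = linearChange (α * β) := by
  ext j : 1
  simp only [AlgHom.comp_apply, linearChange_X, map_sum, map_mul, algHom_C, algebraMap_eq,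
    Units.val_mul, Matrix.mul_apply, Finset.mul_sum, Finset.sum_mul]
  rw [Finset.sum_comm]
  exact Finset.sum_congr rfl fun _ _ => Finset.sum_congr rfl fun _ _ => by ring

theorem linearChange_one : linearChange (1 : GL (Fin n) k) = AlgHom.id k _ := by
  ext j : 1
  simp [linearChange_X, Matrix.one_apply]

/-- A linear change of coordinates, as an automorphism. -/
noncomputable def linearChangeEquiv (α : GL (Fin n) k) :
    MvPolynomial (Fin n) k ≃ₐ[k] MvPolynomial (Fin n) k :=
  AlgEquiv.ofAlgHom (linearChange α) (linearChange α⁻¹)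
    (by rw [linearChange_comp, mul_inv_cancel, linearChange_one])
    (by rw [linearChange_comp, inv_mul_cancel, linearChange_one])

theorem linearChangeEquiv_apply (α : GL (Fin n) k) (f : MvPolynomial (Fin n) k) :
    linearChangeEquiv α f = linearChange α f := rfl

theorem map_linearChange (α : GL (Fin n) k) (I : Ideal (MvPolynomial (Fin n) k)) :
    I.map (linearChange α) = I.map (linearChangeEquiv α) := rfl

theorem map_linearChange_inv_map (α : GL (Fin n) k) (I : Ideal (MvPolynomial (Fin n) k)) :
    (I.map (linearChange α)).map (linearChange α⁻¹) = I := by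
  have h : (linearChange α⁻¹ : _ →ₐ[k] _).toRingHom.comp (linearChange α).toRingHom
      = RingHom.id (MvPolynomial (Fin n) k) := by
    have := linearChange_comp α⁻¹ α
    rw [inv_mul_cancel, linearChange_one] at this
    refine RingHom.ext fun x => ?_
    exact DFunLike.congr_fun this x
  have := Ideal.map_map (I := I) (linearChange α).toRingHom (linearChange α⁻¹).toRingHom
  rw [h, Ideal.map_id] at this
  exact this

theorem linearChange_isHomogeneous (α : GL (Fin n) k) {f : MvPolynomial (Fin n) k} {d : ℕ}
    (hf : f.IsHomogeneous d) : (linearChange α f).IsHomogeneous d := by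
  have := hf.aeval (S := k) (fun j => ∑ i, C (α i j) * X i) (n := 1) (fun j =>
    IsHomogeneous.sum _ _ _ fun i _ => by
      simpa using (isHomogeneous_C (Fin n) (α i j)).mul (isHomogeneous_X k i))
  simpa [linearChange] using this

/-- Degrees are preserved, so the other components cannot contribute; this reduces a general `f` to
forms. -/
theorem coeff_linearChange (α : GL (Fin n) k) (f : MvPolynomial (Fin n) k) (m : Fin n →₀ ℕ) :
    coeff m (linearChange α f) = coeff m (linearChange α (homogeneousComponent m.degree f)) := by
  conv_lhs => rw [← sum_homogeneousComponent f, map_sum, coeff_sum]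
  have key : ∀ i, i ≠ m.degree → coeff m (linearChange α (homogeneousComponent i f)) = 0 := by
    intro i hi
    exact (linearChange_isHomogeneous α (homogeneousComponent_isHomogeneous i f)).coeff_eq_zero
      (Ne.symm hi)
  by_cases hm : m.degree < f.totalDegree + 1
  · exact Finset.sum_eq_single_of_mem _ (Finset.mem_range.mpr hm) fun i _ => key i
  · rw [homogeneousComponent_eq_zero _ _ (by omega), map_zero, coeff_zero]
    exact Finset.sum_eq_zero fun i hi => key i (by rw [Finset.mem_range] at hi; omega)

theorem eval_single_linearChange (α : GL (Fin n) k) (f : MvPolynomial (Fin n) k) (i : Fin n) :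
    eval (Pi.single i 1) (linearChange α f) = eval (fun j => α i j) f := by
  rw [← coe_aeval_eq_eval, ← coe_aeval_eq_eval]
  have : (aeval (Pi.single i (1 : k))).comp (linearChange α) = aeval (fun j => α i j) := by
    ext j
    simp [linearChange_X, Pi.single_apply]
  exact DFunLike.congr_fun this f

end LinearChange

/-! ### Leading monomials after a change of coordinates -/

theorem MvPolynomial.homogeneousComponent_totalDegree_ne_zero {σ R : Type*} [CommSemiring R]
    {f : MvPolynomial σ R} (hf : f ≠ 0) : homogeneousComponent f.totalDegree f ≠ 0 := by
  obtain ⟨m, hm, hmd⟩ := Finset.exists_mem_eq_sup f.support (support_nonempty.mpr hf)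
    Finsupp.degree
  intro h
  apply mem_support_iff.mp hm
  have := congrArg (coeff m) h
  rwa [coeff_homogeneousComponent, if_pos, coeff_zero] at this
  rw [← hmd]
  rfl

/-- At a coordinate point only the pure powers of that variable survive, and a form of degree `d`
has just one. -/
theorem MvPolynomial.IsHomogeneous.coeff_single_ne_zero_of_eval_ne_zero {σ k : Type*}
    [DecidableEq σ] [Field k] {g : MvPolynomial σ k} {d : ℕ} (hg : g.IsHomogeneous d) (i : σ)
    (h : eval (Pi.single i 1) g ≠ 0) : coeff (Finsupp.single i d) g ≠ 0 := by
  rw [eval_eq] at h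
  obtain ⟨m, hm, h⟩ := Finset.exists_ne_zero_of_sum_ne_zero h
  have hsupp : ∀ j, j ≠ i → m j = 0 := by
    intro j hj
    by_contra hmj
    apply h
    rw [Finset.prod_eq_zero (i := j) (by simpa using hmj) (by simp [hj, hmj]), mul_zero]
  have hm' : m = Finsupp.single i (m i) := by
    ext j
    by_cases hj : j = i
    · simp [hj]
    · rw [hsupp j hj, Finsupp.single_eq_of_ne hj]
  have hd : m.degree = d := by
    by_contra hne
    exact (mem_support_iff.mp hm) (hg.coeff_eq_zero hne)
  rw [hm', Finsupp.degree_single] at hd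
  rw [← hd, ← hm']
  exact mem_support_iff.mp hm

theorem degRevLex_le_single {n : ℕ} [NeZero n] {m : Fin n →₀ ℕ} {d : ℕ} (hm : m.degree ≤ d) :
    (degRevLex n).toSyn m ≤ (degRevLex n).toSyn (Finsupp.single 0 d) := by
  change DegRevLex.equiv n m ≤ DegRevLex.equiv n _
  rw [← not_lt, DegRevLex.lt_iff, Finsupp.degree_single]
  rintro (h | ⟨h, i, hi, hlt⟩)
  · omega
  · by_cases hi0 : i = 0
    · subst hi0
      have hm0 : m = Finsupp.single 0 (m 0) := by
        ext j
        by_cases hj : j = 0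
        · simp [hj]
        · rw [Finsupp.single_eq_of_ne hj, ← hi j (Fin.pos_iff_ne_zero.mpr hj),
            Finsupp.single_eq_of_ne hj]
      rw [hm0, Finsupp.degree_single] at h
      rw [Finsupp.single_eq_same, h] at hlt
      exact lt_irrefl _ hlt
    · rw [Finsupp.single_eq_of_ne hi0] at hlt
      exact absurd hlt (Nat.not_lt_zero _)

theorem degree_linearChange_degRevLex {n : ℕ} [NeZero n] {k : Type*} [Field k] (α : GL (Fin n) k)
    (f : MvPolynomial (Fin n) k)
    (h : eval (fun j => α 0 j) (homogeneousComponent f.totalDegree f) ≠ 0) :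
    (degRevLex n).degree (linearChange α f) = Finsupp.single 0 f.totalDegree := by
  apply (degRevLex n).toSyn.injective
  apply le_antisymm
  · rw [MonomialOrder.degree_le_iff]
    intro m hm
    apply degRevLex_le_single
    by_contra hlt
    rw [mem_support_iff, coeff_linearChange, homogeneousComponent_eq_zero _ _ (by omega)] at hm
    simp at hm
  · apply MonomialOrder.le_degree
    rw [mem_support_iff, coeff_linearChange, Finsupp.degree_single]
    apply (linearChange_isHomogeneous α
      (homogeneousComponent_isHomogeneous _ f)).coeff_single_ne_zero_of_eval_ne_zero
    rwa [eval_single_linearChange]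

/-! ### Initial ideals of height one -/

theorem initialIdeal_bot {n : ℕ} {k : Type*} [Field k] (m : MonomialOrder (Fin n)) :
    initialIdeal m (⊥ : Ideal (MvPolynomial (Fin n) k)) = ⊥ := by
  rw [initialIdeal, Ideal.span_eq_bot]
  rintro _ ⟨f, hf, hf0, -⟩
  exact absurd hf hf0

theorem initialIdeal_span_singleton {n : ℕ} {k : Type*} [Field k] (m : MonomialOrder (Fin n))
    {f : MvPolynomial (Fin n) k} (hf : f ≠ 0) :
    initialIdeal m (Ideal.span {f}) = Ideal.span {monomial (m.degree f) 1} := by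
  apply le_antisymm
  · rw [initialIdeal, Ideal.span_le]
    rintro _ ⟨g, hg, hg0, rfl⟩
    obtain ⟨h, rfl⟩ := Ideal.mem_span_singleton.mp hg
    rw [SetLike.mem_coe, Ideal.mem_span_singleton, m.degree_mul hf (right_ne_zero_of_mul hg0)]
    exact ⟨monomial (m.degree h) 1, by rw [monomial_mul, one_mul]⟩
  · rw [Ideal.span_singleton_le_iff_mem]
    exact Ideal.subset_span ⟨f, Ideal.mem_span_singleton_self f, hf, rfl⟩

/-- An initial ideal of height one is contained in the ideal of some variable. -/
theorem exists_initialIdeal_le_span_X {n : ℕ} {k : Type*} [Field k] (m : MonomialOrder (Fin n))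
    {I : Ideal (MvPolynomial (Fin n) k)} (h : (initialIdeal m I).height = 1) :
    ∃ i, initialIdeal m I ≤ Ideal.span {X i} := by
  obtain ⟨p, hp, hle, hh⟩ := Ideal.exists_isPrime_height_eq (n := 1) (by simpa using h)
  have hI : I ≠ ⊥ := by
    rintro rfl
    simp [initialIdeal_bot] at h
  obtain ⟨f, hf, hf0⟩ := Submodule.exists_mem_ne_zero_of_ne_bot hI
  have hmon : monomial (m.degree f) (1 : k) ∈ p := hle (Ideal.subset_span ⟨f, hf, hf0, rfl⟩)
  rw [monomial_eq, map_one, one_mul, Finsupp.prod, hp.prod_mem_iff] at hmon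
  obtain ⟨i, -, hi⟩ := hmon
  have hXp : X i ∈ p := hp.mem_of_pow_mem _ hi
  refine ⟨i, ?_⟩
  have hXprime : (Ideal.span {(X i : MvPolynomial (Fin n) k)}).IsPrime :=
    (Ideal.span_singleton_prime (X_ne_zero i)).mpr X_prime
  have hXle : Ideal.span {(X i : MvPolynomial (Fin n) k)} ≤ p :=
    (Ideal.span_singleton_le_iff_mem _).mpr hXp
  -- A strict inclusion would be a chain forcing `p` to have height at least two.
  rcases hXle.eq_or_lt with heq | hlt
  · rwa [heq]
  · have h1 := Ideal.height_add_one_le_of_lt_of_isPrime hlt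
    have h2 : (Ideal.span {(X i : MvPolynomial (Fin n) k)}).height ≠ 0 := by
      rw [Ne, Ideal.height_eq_zero_iff_eq_bot, Ideal.span_singleton_eq_bot]
      exact X_ne_zero i
    rw [hh, Nat.cast_one] at h1
    have h3 := (add_le_add_left (Order.one_le_iff_ne_zero.mpr h2) 1).trans h1
    exact absurd h3 (by norm_num)

/-- A prime whose initial ideal has height one is principal. -/
theorem isPrincipal_of_height_initialIdeal_eq_one {n : ℕ} {k : Type*} [Field k]
    (m : MonomialOrder (Fin n)) {Q : Ideal (MvPolynomial (Fin n) k)} [Q.IsPrime]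
    (h : (initialIdeal m Q).height = 1) : ∃ f, Q = Ideal.span {f} := by
  obtain ⟨i, hi⟩ := exists_initialIdeal_le_span_X m h
  refine MvPolynomial.isPrincipal_of_isPrime_of_notMem_vars i ?_ ?_
  · rintro rfl
    simp [initialIdeal_bot] at h
  · intro g hg hgi
    by_contra hg0
    have hdvd := Ideal.mem_span_singleton.mp (hi (Ideal.subset_span ⟨g, hg, hg0, rfl⟩))
    rw [X_dvd_monomial] at hdvd
    refine hgi ((mem_vars_iff_mem_support i).mpr ⟨m.degree g, m.degree_mem_support hg0, ?_⟩)
    simpa using hdvd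

/-- A nonempty Zariski open set meets the locus where a given nonzero form does not vanish
at a given row. -/
theorem IsZariskiOpen.exists_mem_eval_row_ne_zero {n : ℕ} {k : Type*} [Field k] [Infinite k]
    {U : Set (GL (Fin n) k)} (hU : IsZariskiOpen U) (hne : U.Nonempty) (i : Fin n)
    {F : MvPolynomial (Fin n) k} (hF : F ≠ 0) : ∃ α ∈ U, eval (fun j => α i j) F ≠ 0 := by
  obtain ⟨T, rfl⟩ := hU
  obtain ⟨β, p, hpT, hp⟩ := hne
  have hp0 : p ≠ 0 := by rintro rfl; simp at hp
  let D : MvPolynomial (Fin n × Fin n) k := (Matrix.of fun i j => X (i, j)).det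
  have hD : ∀ x : Fin n × Fin n → k, eval x D = (Matrix.of fun i j => x (i, j)).det := by
    intro x
    rw [RingHom.map_det]
    congr 1
    ext a b
    simp
  have hD0 : D ≠ 0 := by
    intro h
    have := hD fun ij => (1 : Matrix (Fin n) (Fin n) k) ij.1 ij.2
    rw [h, map_zero] at this
    have h1 : (Matrix.of fun i j => (1 : Matrix (Fin n) (Fin n) k) i j) = 1 := rfl
    rw [h1, Matrix.det_one] at this
    exact zero_ne_one this
  have hF0 : rename (fun j => (i, j)) F ≠ 0 := by
    rwa [Ne, map_eq_zero_iff _ (rename_injective _ (Prod.mk_right_injective i))]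
  -- A point where this product is nonzero is an invertible matrix lying in the open set, with row
  -- `i` off the zero locus of `F`.
  have hmul : p * D * rename (fun j => (i, j)) F ≠ 0 := mul_ne_zero (mul_ne_zero hp0 hD0) hF0
  obtain ⟨x, hx⟩ : ∃ x, eval x (p * D * rename (fun j => (i, j)) F) ≠ 0 := by
    by_contra! h
    exact hmul (MvPolynomial.funext fun x => by rw [h x, map_zero])
  rw [map_mul, map_mul, hD, eval_rename] at hx
  have hdet := right_ne_zero_of_mul (left_ne_zero_of_mul hx)
  exact ⟨Matrix.GeneralLinearGroup.mkOfDetNeZero _ hdet,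
    ⟨p, hpT, left_ne_zero_of_mul (left_ne_zero_of_mul hx)⟩, right_ne_zero_of_mul hx⟩

theorem corollary6p2 {k : Type*} [Field k] [Infinite k] {n : ℕ} [NeZero n]
    (P J : Ideal (MvPolynomial (Fin n) k)) (hP : P.IsPrime)
    (hPhom : P.IsHomogeneous (MvPolynomial.homogeneousSubmodule (Fin n) k))
    (hJ : IsGin J P) (hht : J.height = 1) :
    ∃ e : ℕ, 0 < e ∧ J = Ideal.span {(MvPolynomial.X 0 : MvPolynomial (Fin n) k) ^ e} := by
  obtain ⟨U, hU, hne, hgin⟩ := hJ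
  obtain ⟨f, rfl⟩ : ∃ f, P = Ideal.span {f} := by
    obtain ⟨α, hα⟩ := hne
    have : (P.map (linearChange α)).IsPrime := by
      rw [map_linearChange]
      exact Ideal.map_isPrime_of_equiv (linearChangeEquiv α)
    obtain ⟨g, hg⟩ := isPrincipal_of_height_initialIdeal_eq_one (degRevLex n)
      (Q := P.map (linearChange α)) (by rw [hgin α hα, hht])
    refine ⟨linearChange α⁻¹ g, ?_⟩
    rw [← map_linearChange_inv_map α P, hg, Ideal.map_span, Set.image_singleton]
  have hf0 : f ≠ 0 := by
    rintro rfl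
    obtain ⟨α, hα⟩ := hne
    have := hgin α hα
    rw [Ideal.span_singleton_eq_bot.mpr rfl, Ideal.map_bot] at this
    rw [← this, initialIdeal_bot] at hht
    simp at hht
  obtain ⟨α, hα, hev⟩ := hU.exists_mem_eval_row_ne_zero hne 0
    (homogeneousComponent_totalDegree_ne_zero hf0)
  have hJ := hgin α hα
  have hαf : linearChange α f ≠ 0 := by
    rwa [← linearChangeEquiv_apply, Ne, EmbeddingLike.map_eq_zero_iff]
  rw [Ideal.map_span, Set.image_singleton, initialIdeal_span_singleton _ hαf,
    degree_linearChange_degRevLex α f hev, ← X_pow_eq_monomial] at hJ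
  refine ⟨f.totalDegree, Nat.pos_of_ne_zero fun hd => ?_, hJ.symm⟩
  -- Exponent zero would give the unit ideal, whose height is `⊤`.
  rw [hd, pow_zero, Ideal.span_singleton_one] at hJ
  rw [← hJ, Ideal.height_top] at hht
  simp at hht
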